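/- Let $\alpha>0$ be a constant and let $t\in\mathbb N$. Then there are constants $K=K(\alpha,t)>0$ and $c=c(\alpha,t)>0$ such that the following holds for every $s\in\mathbb N$ with $2\le s\le t$. Let $G$ be a graph on $n$ vertices which is $K_{s,t}$-free (it contains no copy of the complete bipartite graph $K_{s,t}$ as a, not necessarily induced, subgraph) and has at least $\alpha n^{2-1/s}$ edges, and let $\frac{K}{n^{1-1/s}}\le p\le 1$. Let $G_p$ be the random subgraph of $G$ obtained by retaining each edge of $G$ independently with probability $p$. Then, with high probability, $G_p$ contains a cycle of length at least $cn$. Here "with high probability" means with probability tending to $1$ as $n\to\infty$, uniformly in $s$, $G$ and $p$: for every $\eta>0$ there is $n_0=n_0(\alpha,t,\eta)$ such that for all $n\ge n_0$ and all $s$, $G$ and $p$ as above, the probability is at least $1-\eta$. -/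

import Mathlib

open MeasureTheory ProbabilityTheory

/-- The law of the random subgraph `G_p` of a host graph `G`: every edge of `G` is retained
independently with probability `p`, and no other edge is present. -/
noncomputable def SimpleGraph.percolation {V : Type*} (G : SimpleGraph V) (p : unitInterval) :
    Measure (SimpleGraph V) :=
  (setBernoulli G.edgeSet p).comap SimpleGraph.edgeSet

instance SimpleGraph.isProbabilityMeasure_percolation {V : Type*} [Countable V]
    (G : SimpleGraph V) (p : unitInterval) : IsProbabilityMeasure (G.percolation p) := by
  refine SimpleGraph.measurableEmbedding_edgeSet.isProbabilityMeasure_comap ?_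
  filter_upwards [setBernoulli_ae_subset] with s hs
  refine ⟨SimpleGraph.fromEdgeSet s, ?_⟩
  rw [SimpleGraph.edgeSet_fromEdgeSet, sdiff_eq_left, Set.disjoint_left]
  exact fun e he hd => G.not_isDiag_of_mem_edgeSet (hs he) hd

/-- Each spanning subgraph `H ≤ G` occurs with probability `p ^ e(H) * (1 - p) ^ (e(G) - e(H))`. -/
theorem SimpleGraph.percolation_real_singleton {V : Type*} [Finite V] (G H : SimpleGraph V)
    (hH : H ≤ G) (p : unitInterval) :
    (G.percolation p).real {H} =
      (p : ℝ) ^ H.edgeSet.ncard * (1 - p : ℝ) ^ (G.edgeSet \ H.edgeSet).ncard := by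
  rw [← setBernoulli_real_singleton p (SimpleGraph.edgeSet_mono hH) (Set.toFinite _),
    SimpleGraph.percolation, measureReal_def, measureReal_def,
    SimpleGraph.measurableEmbedding_edgeSet.comap_apply, Set.image_singleton]

/-- The graph `H` contains a cycle with at least `ℓ` edges. -/
def SimpleGraph.HasCycleOfLengthAtLeast {V : Type*} (H : SimpleGraph V) (ℓ : ℝ) : Prop :=
  ∃ (v : V) (w : H.Walk v v), w.IsCycle ∧ ℓ ≤ (w.length : ℝ)

/-!
Averaging gives a set `U` all of whose vertices have at least `α * n ^ (1 - 1 / s)` neighbors in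
`U`. By Kővári–Sós–Turán, a set `M` of size at most `γ ^ 2 * n` spans too few edges to absorb the
degrees of a comparably large `W ⊆ M`, so about `n ^ (2 - 1 / s)` edges lead from `W` to `U \ M`.
For `p ≥ K / n ^ (1 - 1 / s)` the chance that `G_p` loses all of them is at most `exp (-3 * n)`,
and a union bound over the at most `4 ^ n` pairs `(W, M)` shows that in `G_p` each subset of `U` of
size between `k / 2` and `k` has at least `k` neighbors in `U` outside it, where `k` is about
`γ ^ 2 * n / 2`. Such an expander has a long cycle: a depth-first search reaches a set of this
size all of whose outer neighbors lie on the current path, and the last stretch of the path,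
starting from the first of these neighbors, closes up through the part of the graph not yet
explored.
-/

section CyclesInExpanders

open Finset SimpleGraph

variable {V : Type*} {G : SimpleGraph V}

theorem exists_dropUntil_support_superset [DecidableEq V] {a v : V} (p : G.Walk a v) {N : Finset V}
    (hN : N.Nonempty) (hNp : ∀ y ∈ N, y ∈ p.support) :
    ∃ x ∈ N, ∃ hx : x ∈ p.support, ∀ y ∈ N, y ∈ (p.dropUntil x hx).support := by
  have hmeets : ({x ∈ N | x ∈ p.support} : Finset V).Nonempty := by
    rwa [filter_true_of_mem hNp]
  obtain ⟨x, hxN, hx, hfirst⟩ := p.exists_mem_support_forall_mem_support_imp_eq N hmeets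
  refine ⟨x, hxN, hx, fun y hy => ?_⟩
  have hy' : y ∈ ((p.takeUntil x hx).append (p.dropUntil x hx)).support := by
    rw [p.take_spec hx]
    exact hNp y hy
  rcases (Walk.mem_support_append_iff _ _).1 hy' with htake | hdrop
  · obtain rfl := hfirst y hy htake
    exact Walk.start_mem_support _
  · exact hdrop

theorem start_notMem_tail_support_of_isPath {a v : V} {p : G.Walk a v} (hp : p.IsPath) :
    a ∉ p.support.tail :=
  (List.nodup_cons.1 (p.cons_tail_support.symm ▸ hp.support_nodup)).1

theorem exists_isPath_of_preconnected_induce {D : Set V} (hD : (G.induce D).Preconnected)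
    {w v : V} (hw : w ∈ D) (hv : v ∈ D) : ∃ r : G.Walk w v, r.IsPath ∧ ∀ y ∈ r.support, y ∈ D := by
  classical
  obtain ⟨r⟩ := hD ⟨w, hw⟩ ⟨v, hv⟩
  let r' : G.Walk w v := r.map (Embedding.induce D).toHom
  refine ⟨r'.bypass, r'.bypass_isPath, fun y hy => ?_⟩
  have hy' : y ∈ (r.map (Embedding.induce D).toHom).support :=
    r'.support_bypass_subset_support hy
  rw [Walk.support_map] at hy'
  obtain ⟨z, -, rfl⟩ := List.mem_map.1 hy'
  exact z.2

theorem hasCycleOfLengthAtLeast_of_path_neighbors {a v : V} {p : G.Walk a v} (hp : p.IsPath)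
    {D : Set V} (hD : (G.induce D).Preconnected) (hv : v ∈ D)
    (hDp : ∀ y ∈ D, y ∈ p.support → y = v) {N : Finset V}
    (hN : ∀ y ∈ N, y ∈ p.support ∧ ∃ w ∈ D, w ≠ v ∧ G.Adj w y) (hcard : 2 ≤ #N) :
    G.HasCycleOfLengthAtLeast (#N + 1) := by
  classical
  obtain ⟨x, hxN, hx, hNq⟩ := exists_dropUntil_support_superset p
    (card_pos.1 (by lia)) (fun y hy => (hN y hy).1)
  obtain ⟨w, hw, hwv, hwx⟩ := (hN x hxN).2
  obtain ⟨r, hr, hrD⟩ := exists_isPath_of_preconnected_induce hD hw hv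
  set q := p.dropUntil x hx
  have hq : q.IsPath := hp.dropUntil hx
  have hqlen : #N ≤ q.length + 1 := by
    rw [← Walk.length_support, ← List.toFinset_card_of_nodup hq.support_nodup]
    exact card_le_card fun y hy => List.mem_toFinset.2 (hNq y hy)
  have hxr : x ∉ r.support := by
    intro hxr
    obtain rfl := hDp x (hrD x hxr) hx
    have : q.length = 0 := by
      simpa using hq
    lia
  have hxv : x ≠ v := by
    rintro rfl
    exact hxr r.end_mem_support
  have hr' : (r.cons hwx.symm).reverse.IsPath := (hr.cons hxr).reverse
  have hdisj : q.support.tail.Disjoint (r.cons hwx.symm).reverse.support.tail := by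
    intro y hyq hyr
    have hyx : y ≠ x := by
      rintro rfl
      exact start_notMem_tail_support_of_isPath hq hyq
    have hyv : y ≠ v := by
      rintro rfl
      exact start_notMem_tail_support_of_isPath hr' hyr
    have hyr' : y ∈ r.support := by
      simpa only [Walk.support_reverse, Walk.support_cons, List.mem_reverse, List.mem_cons, hyx,
        false_or] using List.mem_of_mem_tail hyr
    exact hyv <| hDp y (hrD y hyr')
      (p.support_dropUntil_subset_support hx (List.mem_of_mem_tail hyq))
  have hrlen : r.length ≠ 0 := fun h => hwv (Walk.eq_of_length_eq_zero h)
  refine ⟨x, q.append (r.cons hwx.symm).reverse, hq.isCycle_append hr' hdisj (Or.inr ?_), ?_⟩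
  · rw [Walk.length_reverse, Walk.length_cons]
    lia
  · rw [Walk.length_append, Walk.length_reverse,
      Walk.length_cons]
    norm_cast
    lia

theorem connected_induce_of_forall_closed_eq {W : Finset V} (hW : W.Nonempty)
    (hclosed : ∀ R ⊆ W, R.Nonempty → (∀ x ∈ R, ∀ y ∈ W, G.Adj x y → y ∈ R) → R = W) :
    (G.induce (W : Set V)).Connected := by
  classical
  have := hW.to_subtype
  refine SimpleGraph.Connected.mk fun u x => ?_
  let R : Finset V :=
    W.filter fun y => ∃ hy : y ∈ W, (G.induce (W : Set V)).Reachable u ⟨y, hy⟩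
  have hRW : R = W := by
    refine hclosed R (filter_subset _ _) ⟨u, mem_filter.2 ⟨u.2, u.2, .rfl⟩⟩ fun y hy z hz hyz => ?_
    obtain ⟨-, hyW, hreach⟩ := mem_filter.1 hy
    have hadj : (G.induce (W : Set V)).Adj ⟨y, hyW⟩ ⟨z, hz⟩ := hyz
    exact mem_filter.2 ⟨hz, hz, hreach.trans hadj.reachable⟩
  have hxR : (x : V) ∈ R := hRW.ge x.2
  exact (mem_filter.1 hxR).2.2

-- A smallest closed `W` with `k ≤ 2 * #W` works: a disconnection would split it into two closed
-- sets, each of size less than `k / 2`.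
theorem exists_closed_small_or_connected (G : SimpleGraph V) {C : Finset V} {k : ℕ}
    (hk : k ≤ #C) :
    ∃ W ⊆ C, k ≤ 2 * #W ∧ (∀ x ∈ W, ∀ y ∈ C, G.Adj x y → y ∈ W) ∧
      (#W ≤ k ∨ (G.induce (W : Set V)).Connected) := by
  classical
  obtain ⟨W, hW, hmin⟩ := exists_min_image
    {W ∈ C.powerset | k ≤ 2 * #W ∧ ∀ x ∈ W, ∀ y ∈ C, G.Adj x y → y ∈ W} card
    ⟨C, by simpa using ⟨by lia, fun _ _ _ hy _ => hy⟩⟩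
  simp only [mem_filter, mem_powerset] at hW hmin
  obtain ⟨hWC, hkW, hWclosed⟩ := hW
  refine ⟨W, hWC, hkW, hWclosed, or_iff_not_imp_left.2 fun hWk => ?_⟩
  have small_of_closed : ∀ R ⊆ W, R ≠ W → (∀ x ∈ R, ∀ y ∈ W, G.Adj x y → y ∈ R) → 2 * #R < k := by
    intro R hRW hne hR
    by_contra! hkR
    have hWR : #W ≤ #R := hmin R ⟨hRW.trans hWC, hkR, fun x hx y hy hxy =>
      hR x hx y (hWclosed x (hRW hx) y hy hxy) hxy⟩
    exact hne (eq_of_subset_of_card_le hRW hWR)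
  refine connected_induce_of_forall_closed_eq (card_pos.1 (by lia)) fun R hRW hRne hR => ?_
  by_contra hne
  have hRsmall := small_of_closed R hRW hne hR
  have hcompl_small := small_of_closed (W \ R) sdiff_subset
    (fun h => hRne.ne_empty ((Finset.sdiff_eq_self_iff_disjoint.1 h).symm.eq_bot_of_le hRW))
    fun x hx y hy hxy => by
      rw [mem_sdiff] at hx ⊢
      exact ⟨hy, fun hyR => hx.2 (hR y hyR x hx.1 hxy.symm)⟩
  have := card_sdiff_add_card_eq_card hRW
  lia

theorem exists_adj_of_preconnected_of_closed {D W : Set V} (hD : (G.induce D).Preconnected)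
    {v : V} (hv : v ∈ D) (hvW : v ∉ W) (hWD : W ⊆ D) (hW : W.Nonempty)
    (hclosed : ∀ x ∈ W, ∀ y ∈ D, y ≠ v → G.Adj x y → y ∈ W) : ∃ u ∈ W, G.Adj v u := by
  obtain ⟨x, hx⟩ := hW
  obtain ⟨q⟩ := hD ⟨x, hWD hx⟩ ⟨v, hv⟩
  obtain ⟨d, -, hfst, hsnd⟩ := q.exists_boundary_dart {y | (y : V) ∈ W} hx hvW
  have hadj : G.Adj d.fst d.snd := d.adj
  have hdv : (d.snd : V) = v := by
    by_contra hne
    exact hsnd (hclosed _ hfst _ d.snd.2 hne hadj)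
  exact ⟨d.fst, hfst, hdv ▸ hadj.symm⟩

open Classical in
/-- `G` sends at least `x` edges from `W` to `U \ M` whenever `W ⊆ M ⊆ U`, `k ≤ 2 * #W` and
`#M < k + m`. With `0 < x` this forces every `W ⊆ U` with `k / 2 ≤ #W ≤ k` to have at least `m`
neighbors in `U \ W`, and unlike that conclusion it survives the deletion of random edges. -/
def IsRobustExpander (G : SimpleGraph V) (U : Finset V) (k m : ℕ) (x : ℝ) : Prop :=
  ∀ W M : Finset V, W ⊆ M → M ⊆ U → k ≤ 2 * #W → #M < k + m → x ≤ #(G.interedges W (U \ M))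

namespace IsRobustExpander

variable {U : Finset V} {k m : ℕ} {x : ℝ}

open Classical in
theorem le_card_neighbors (hG : IsRobustExpander G U k m x) (hx : 0 < x) {W : Finset V}
    (hWU : W ⊆ U) (hkW : k ≤ 2 * #W) (hWk : #W ≤ k) :
    m ≤ #{y ∈ U \ W | ∃ w ∈ W, G.Adj w y} := by
  by_contra! hlt
  set N : Finset V := {y ∈ U \ W | ∃ w ∈ W, G.Adj w y} with hN
  have hM : #(W ∪ N) < k + m := (card_union_le _ _).trans_lt (by lia)
  have hNU : N ⊆ U := (filter_subset _ _).trans sdiff_subset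
  have hpos : 0 < #(G.interedges W (U \ (W ∪ N))) := by
    exact_mod_cast hx.trans_le (hG W (W ∪ N) subset_union_left (union_subset hWU hNU) hkW hM)
  obtain ⟨⟨w, y⟩, hwy⟩ := card_pos.1 hpos
  obtain ⟨hw, hy, hadj⟩ := mk_mem_interedges_iff _ |>.1 hwy
  simp only [mem_sdiff, mem_union, hN, mem_filter, not_or] at hy
  exact hy.2.2 ⟨⟨hy.1, hy.2.1⟩, w, hw, hadj⟩

theorem hasCycleOfLengthAtLeast_of_small_closed (hG : IsRobustExpander G U k m x) (hx : 0 < x)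
    (hm : 2 ≤ m) {a v : V} {p : G.Walk a v} (hp : p.IsPath) {D : Finset V}
    (hD : (G.induce (D : Set V)).Preconnected) (hv : v ∈ D)
    (hDp : ∀ y ∈ D, y ∈ p.support → y = v) {W : Finset V} (hWU : W ⊆ U) (hkW : k ≤ 2 * #W)
    (hWk : #W ≤ k) (hWD : ∀ y ∈ W, y ∈ D ∧ y ≠ v)
    (hclosed : ∀ y ∈ W, ∀ z ∈ U, G.Adj y z → z ∈ W ∨ z ∈ p.support) :
    G.HasCycleOfLengthAtLeast (m + 1) := by
  classical
  have hmN := hG.le_card_neighbors hx hWU hkW hWk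
  obtain ⟨u, c, hc, hlen⟩ := hasCycleOfLengthAtLeast_of_path_neighbors hp hD hv hDp
    (N := {y ∈ U \ W | ∃ w ∈ W, G.Adj w y}) (fun y hy => by
      simp only [mem_filter, mem_sdiff] at hy
      obtain ⟨⟨hyU, hyW⟩, w, hw, hwy⟩ := hy
      exact ⟨(hclosed w hw y hyU hwy).resolve_left hyW, w, (hWD w hw).1, (hWD w hw).2, hwy⟩)
    (hm.trans hmN)
  exact ⟨u, c, hc, hlen.trans' (by gcongr)⟩

-- `p` is the current path of a depth-first search and `D` the part of `U` still to be explored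
-- from its endpoint. The search moves into a closed connected part of `D.erase v`; once no part
-- larger than `k` is left, the neighbors of a part of size about `k` all lie on the path.
theorem hasCycleOfLengthAtLeast_of_path (hG : IsRobustExpander G U k m x) (hx : 0 < x)
    (hm : 2 ≤ m) {a v : V} {p : G.Walk a v} (hp : p.IsPath) {D : Finset V} (hDU : D ⊆ U)
    (hkD : k < #D) (hv : v ∈ D) (hD : (G.induce (D : Set V)).Preconnected)
    (hDp : ∀ y ∈ D, y ∈ p.support → y = v)
    (hclosed : ∀ y ∈ D, y ≠ v → ∀ z ∈ U, G.Adj y z → z ∈ D ∨ z ∈ p.support) :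
    G.HasCycleOfLengthAtLeast (m + 1) := by
  classical
  induction hcard : #D using Nat.strong_induction_on generalizing v D with
  | _ d ih =>
    have hCcard : #(D.erase v) + 1 = #D := card_erase_add_one hv
    obtain ⟨W, hWC, hkW, hWclosed, hW⟩ :=
      exists_closed_small_or_connected G (C := D.erase v) (k := k) (by lia)
    have hWD : W ⊆ D := hWC.trans (erase_subset _ _)
    have hvW : v ∉ W := fun hvW => notMem_erase v D (hWC hvW)
    have ne_of_mem : ∀ y ∈ W, y ≠ v := fun y hy hyv => hvW (hyv ▸ hy)
    have mem_or_mem_support : ∀ y ∈ W, ∀ z ∈ U, G.Adj y z → z ∈ W ∨ z ∈ p.support := by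
      intro y hy z hz hyz
      by_cases hzv : z = v
      · exact Or.inr (hzv ▸ p.end_mem_support)
      · exact (hclosed y (hWD hy) (ne_of_mem y hy) z hz hyz).imp_left fun hzD =>
          hWclosed y hy z (mem_erase.2 ⟨hzv, hzD⟩) hyz
    rcases le_or_gt (#W) k with hWk | hWk
    · exact hG.hasCycleOfLengthAtLeast_of_small_closed hx hm hp hD hv hDp (hWD.trans hDU) hkW hWk
        (fun y hy => ⟨hWD hy, ne_of_mem y hy⟩) mem_or_mem_support
    · have hWconn := (hW.resolve_left hWk.not_ge).preconnected
      obtain ⟨u, hu, hvu⟩ := exists_adj_of_preconnected_of_closed (W := W) hD hv hvW hWD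
        (coe_nonempty.2 <| card_pos.1 (by lia)) fun y hy z hz hzv =>
          hWclosed y hy z (mem_erase.2 ⟨hzv, hz⟩)
      have not_mem_support : ∀ y ∈ W, y ∉ p.support := fun y hy hyp =>
        ne_of_mem y hy (hDp y (hWD hy) hyp)
      have hWcard := card_le_card hWC
      refine ih #W (by lia) (hp.concat (not_mem_support u hu) hvu) (hWD.trans hDU) hWk hu hWconn
        (fun y hy hyp => ?_) (fun y hy _ z hz hyz => ?_) rfl
      · rw [Walk.support_concat, List.mem_append, List.mem_singleton] at hyp
        exact hyp.resolve_left (not_mem_support y hy)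
      · rw [Walk.support_concat, List.mem_append, List.mem_singleton]
        exact (mem_or_mem_support y hy z hz hyz).imp_right Or.inl

theorem hasCycleOfLengthAtLeast (hG : IsRobustExpander G U k m x) (hx : 0 < x) (hm : 2 ≤ m)
    (hkU : k ≤ #U) : G.HasCycleOfLengthAtLeast (m + 1) := by
  classical
  obtain ⟨W, hWU, hkW, hWclosed, hW⟩ := exists_closed_small_or_connected G hkU
  rcases le_or_gt (#W) k with hWk | hWk
  · have hmN := hG.le_card_neighbors hx hWU hkW hWk
    obtain ⟨y, hy⟩ := card_pos.1 (lt_of_lt_of_le (by lia) hmN)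
    simp only [mem_filter, mem_sdiff] at hy
    obtain ⟨⟨hyU, hyW⟩, w, hw, hwy⟩ := hy
    exact absurd (hWclosed w hw y hyU hwy) hyW
  · obtain ⟨v, hv⟩ : W.Nonempty := card_pos.1 (by lia)
    exact hG.hasCycleOfLengthAtLeast_of_path hx hm (Walk.IsPath.nil (u := v)) hWU hWk hv
      (hW.resolve_left hWk.not_ge).preconnected (fun y _ hy => by simpa using hy)
      fun y hy _ z hz hyz => Or.inl (hWclosed y hy z hz hyz)

end IsRobustExpander

end CyclesInExpanders

section EdgeCounting

open Finset SimpleGraph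

variable {V : Type*} (G : SimpleGraph V)

section DecidableRel

variable [DecidableRel G.Adj]

theorem card_interedges_eq_sum (A B : Finset V) :
    #(G.interedges A B) = ∑ a ∈ A, #{b ∈ B | G.Adj a b} := by
  simp only [interedges_def, card_filter, sum_product]

theorem card_mul_le_card_interedges {A B : Finset V} {δ : ℝ}
    (hδ : ∀ a ∈ A, δ ≤ #{b ∈ B | G.Adj a b}) : #A * δ ≤ #(G.interedges A B) := by
  rw [card_interedges_eq_sum, Nat.cast_sum, ← nsmul_eq_mul]
  exact card_nsmul_le_sum A _ δ hδ

theorem card_interedges_univ [Fintype V] : #(G.interedges univ univ) = 2 * G.edgeSet.ncard := by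
  classical
  rw [card_interedges_eq_sum, ← coe_edgeFinset, Set.ncard_coe_finset,
    ← G.sum_degrees_eq_twice_card_edges]
  simp only [← card_neighborFinset_eq_degree, neighborFinset_eq_filter]

theorem card_interedges_add_sdiff [DecidableEq V] (A : Finset V) {M U : Finset V} (hMU : M ⊆ U) :
    #(G.interedges A M) + #(G.interedges A (U \ M)) = #(G.interedges A U) := by
  simp only [card_interedges_eq_sum, ← sum_add_distrib]
  refine sum_congr rfl fun a _ => ?_
  rw [← card_union_of_disjoint (disjoint_filter_filter disjoint_sdiff), ← filter_union,
    union_sdiff_of_subset hMU]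

theorem card_interedges_erase_add [DecidableEq V] {U : Finset V} {v : V} (hv : v ∈ U) :
    #(G.interedges (U.erase v) (U.erase v)) + 2 * #{w ∈ U | G.Adj v w} = #(G.interedges U U) := by
  have hcard : ∀ a, #{b ∈ U | G.Adj a b} =
      #{b ∈ U.erase v | G.Adj a b} + if G.Adj a v then 1 else 0 := fun a => by
    rw [card_filter, card_filter, sum_erase_add _ _ hv]
  have hdeg : #{w ∈ U | G.Adj v w} = ∑ a ∈ U.erase v, if G.Adj a v then 1 else 0 := by
    simp only [card_filter, G.adj_comm v, ← sum_erase_add _ _ hv, G.irrefl, if_false, add_zero]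
  rw [card_interedges_eq_sum, card_interedges_eq_sum, ← sum_erase_add U _ hv,
    sum_congr rfl fun a _ => hcard a, sum_add_distrib, ← hdeg]
  ring

theorem exists_nonempty_forall_ncard_edgeSet_le [Fintype V] [Nonempty V] :
    ∃ U : Finset V, U.Nonempty ∧
      ∀ v ∈ U, G.edgeSet.ncard ≤ Fintype.card V * #{w ∈ U | G.Adj v w} := by
  classical
  set e := G.edgeSet.ncard
  set n := Fintype.card V
  obtain ⟨U, hU, hmin⟩ := exists_min_image
    {U : Finset V | U.Nonempty ∧ 2 * e * #U ≤ n * #(G.interedges U U)} card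
    ⟨univ, by simp [card_interedges_univ, univ_nonempty, e, n, mul_comm]⟩
  simp only [mem_filter, mem_univ, true_and] at hU hmin
  refine ⟨U, hU.1, fun v hv => ?_⟩
  have herase := card_interedges_erase_add G hv
  have hcard := card_erase_add_one hv
  rcases (U.erase v).eq_empty_or_nonempty with hempty | hne
  · simp only [hempty, card_empty, interedges_empty_left] at hcard herase
    nlinarith
  · have : n * #(G.interedges (U.erase v) (U.erase v)) < 2 * e * #(U.erase v) := by
      by_contra! hle
      have := hmin _ ⟨hne, hle⟩
      lia
    nlinarith

end DecidableRel

variable {G}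

theorem card_common_neighbors_lt_of_free [DecidableRel G.Adj] {s t : ℕ}
    (hG : (completeBipartiteGraph (Fin s) (Fin t)).Free G) (A : Finset V) {S : Finset V}
    (hS : #S = s) : #{a ∈ A | ∀ b ∈ S, G.Adj a b} < t := by
  by_contra! hle
  obtain ⟨R, hR, hRt⟩ := exists_subset_card_eq hle
  refine hG (completeBipartiteGraph_isContained_iff.2 ⟨S, R, by simpa, by simpa, ?_⟩)
  exact fun b hb a ha => ((mem_filter.1 (hR ha)).2 b hb).symm

theorem sum_choose_card_neighbors_le_of_free [DecidableRel G.Adj] {s t : ℕ}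
    (hG : (completeBipartiteGraph (Fin s) (Fin t)).Free G) (A B : Finset V) :
    ∑ a ∈ A, (#{b ∈ B | G.Adj a b}).choose s ≤ t * (#B).choose s := by
  classical
  have hstar : ∀ a, (#{b ∈ B | G.Adj a b}).choose s =
      #{S ∈ B.powersetCard s | ∀ b ∈ S, G.Adj a b} := fun a => by
    rw [← card_powersetCard]
    congr 1
    ext S
    simp only [mem_powersetCard, mem_filter, subset_iff]
    grind
  calc ∑ a ∈ A, (#{b ∈ B | G.Adj a b}).choose s
      = ∑ S ∈ B.powersetCard s, #{a ∈ A | ∀ b ∈ S, G.Adj a b} := by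
        simp only [hstar]
        exact sum_card_bipartiteAbove_eq_sum_card_bipartiteBelow fun a S => ∀ b ∈ S, G.Adj a b
    _ ≤ #(B.powersetCard s) • t := sum_le_card_nsmul _ _ _ fun S hS =>
        (card_common_neighbors_lt_of_free hG A (mem_powersetCard.1 hS).2).le
    _ = t * (#B).choose s := by rw [card_powersetCard, smul_eq_mul, mul_comm]

theorem sum_card_neighbors_pow_le_of_free [DecidableRel G.Adj] {s t : ℕ}
    (hG : (completeBipartiteGraph (Fin s) (Fin t)).Free G) (A B : Finset V) :
    ∑ a ∈ A, (#{b ∈ B | G.Adj a b} + 1 - s) ^ s ≤ t * #B ^ s :=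
  calc ∑ a ∈ A, (#{b ∈ B | G.Adj a b} + 1 - s) ^ s
      ≤ ∑ a ∈ A, s.factorial * (#{b ∈ B | G.Adj a b}).choose s := sum_le_sum fun a _ =>
        (Nat.pow_sub_le_descFactorial _ _).trans_eq (Nat.descFactorial_eq_factorial_mul_choose _ _)
    _ ≤ s.factorial * (t * (#B).choose s) := by
        rw [← mul_sum]
        gcongr
        exact sum_choose_card_neighbors_le_of_free hG A B
    _ = t * (#B).descFactorial s := by
        rw [Nat.descFactorial_eq_factorial_mul_choose]
        ring
    _ ≤ t * #B ^ s := by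
        gcongr
        exact Nat.descFactorial_le_pow _ _

theorem sum_card_neighbors_sub_le_of_free [DecidableRel G.Adj] {s t : ℕ} (hs : s ≠ 0)
    (hG : (completeBipartiteGraph (Fin s) (Fin t)).Free G) (A B : Finset V) :
    ∑ a ∈ A, ((#{b ∈ B | G.Adj a b} + 1 - s : ℕ) : ℝ) ≤
      (t : ℝ) ^ (1 / s : ℝ) * (#A : ℝ) ^ (1 - 1 / s : ℝ) * #B := by
  have hA : ((#A : ℝ) ^ (1 - 1 / s : ℝ)) ^ s = (#A : ℝ) ^ (s - 1) := by
    rw [← Real.rpow_mul_natCast (Nat.cast_nonneg _), sub_mul,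
      one_div_mul_cancel (Nat.cast_ne_zero.2 hs), one_mul,
      ← Nat.cast_pred (Nat.pos_of_ne_zero hs), Real.rpow_natCast]
  have ht : ((t : ℝ) ^ (1 / s : ℝ)) ^ s = t := by
    rw [one_div, Real.rpow_inv_natCast_pow (Nat.cast_nonneg _) hs]
  have hsum : ∑ a ∈ A, ((#{b ∈ B | G.Adj a b} + 1 - s : ℕ) : ℝ) ^ s ≤ t * (#B : ℝ) ^ s :=
    mod_cast sum_card_neighbors_pow_le_of_free hG A B
  have hmean := pow_sum_le_card_mul_sum_pow (s := A)
    (f := fun a => ((#{b ∈ B | G.Adj a b} + 1 - s : ℕ) : ℝ)) (fun _ _ => Nat.cast_nonneg _) (s - 1)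
  rw [Nat.sub_add_cancel (Nat.one_le_iff_ne_zero.2 hs)] at hmean
  refine le_of_pow_le_pow_left₀ hs (by positivity) ?_
  calc (∑ a ∈ A, ((#{b ∈ B | G.Adj a b} + 1 - s : ℕ) : ℝ)) ^ s
      ≤ (#A : ℝ) ^ (s - 1) * ∑ a ∈ A, ((#{b ∈ B | G.Adj a b} + 1 - s : ℕ) : ℝ) ^ s := hmean
    _ ≤ (#A : ℝ) ^ (s - 1) * (t * (#B : ℝ) ^ s) := by gcongr
    _ = ((t : ℝ) ^ (1 / s : ℝ) * (#A : ℝ) ^ (1 - 1 / s : ℝ) * #B) ^ s := by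
      rw [mul_pow, mul_pow, hA, ht]
      ring

/-- The Kővári–Sós–Turán theorem. -/
theorem card_interedges_le_of_free [DecidableRel G.Adj] {s t : ℕ} (hs : s ≠ 0)
    (hG : (completeBipartiteGraph (Fin s) (Fin t)).Free G) (A B : Finset V) :
    (#(G.interedges A B) : ℝ) ≤
      (t : ℝ) ^ (1 / s : ℝ) * (#A : ℝ) ^ (1 - 1 / s : ℝ) * #B + (s - 1) * #A := by
  have hdeg : ∀ a ∈ A, (#{b ∈ B | G.Adj a b} : ℝ) ≤
      ((#{b ∈ B | G.Adj a b} + 1 - s : ℕ) : ℝ) + (s - 1) := fun a _ => by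
    have := le_tsub_add (a := s) (b := #{b ∈ B | G.Adj a b} + 1)
    rify at this
    linarith
  calc (#(G.interedges A B) : ℝ) = ∑ a ∈ A, (#{b ∈ B | G.Adj a b} : ℝ) := by
        rw [card_interedges_eq_sum, Nat.cast_sum]
    _ ≤ ∑ a ∈ A, (((#{b ∈ B | G.Adj a b} + 1 - s : ℕ) : ℝ) + (s - 1)) := sum_le_sum hdeg
    _ = ∑ a ∈ A, ((#{b ∈ B | G.Adj a b} + 1 - s : ℕ) : ℝ) + (s - 1) * #A := by
        rw [sum_add_distrib, sum_const, nsmul_eq_mul, mul_comm]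
    _ ≤ _ := by
        gcongr
        exact sum_card_neighbors_sub_le_of_free hs hG A B

theorem card_interedges_self_le_of_free [DecidableRel G.Adj] {s t : ℕ} (hs : 2 ≤ s) (hst : s ≤ t)
    (hG : (completeBipartiteGraph (Fin s) (Fin t)).Free G) {α γ n : ℝ} (hγ0 : 0 ≤ γ) (hγ1 : γ ≤ 1)
    (hγ : 16 * t * γ ≤ α) (hn : 0 ≤ n) (ht : 16 * t ≤ α * n ^ (1 - 1 / s : ℝ)) {M : Finset V}
    (hM : #M ≤ γ ^ 2 * n) :
    (#(G.interedges M M) : ℝ) ≤ #M * (α * n ^ (1 - 1 / s : ℝ) / 8) := by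
  set r : ℝ := 1 - 1 / s
  have hs' : (2 : ℝ) ≤ s := by exact_mod_cast hs
  have hst' : (s : ℝ) ≤ t := by exact_mod_cast hst
  have hinv : (1 / s : ℝ) ≤ 1 / 2 := by gcongr
  have ht1 : (t : ℝ) ^ (1 / s : ℝ) ≤ t :=
    Real.rpow_le_self_of_one_le (by linarith) (by linarith)
  have hMr : (#M : ℝ) ^ r ≤ γ * n ^ r :=
    calc (#M : ℝ) ^ r ≤ (γ ^ 2 * n) ^ r := by
          gcongr
          simp only [r]
          linarith
      _ = γ ^ (2 * r) * n ^ r := by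
          rw [Real.mul_rpow (by positivity) hn, ← Real.rpow_natCast_mul hγ0, Nat.cast_ofNat]
      _ ≤ γ * n ^ r := by
          gcongr
          exact Real.rpow_le_self_of_le_one hγ0 hγ1 (by simp only [r]; linarith)
  have hKST := card_interedges_le_of_free (by lia) hG M M
  calc (#(G.interedges M M) : ℝ) ≤ (t : ℝ) ^ (1 / s : ℝ) * (#M : ℝ) ^ r * #M + (s - 1) * #M := hKST
    _ ≤ t * (γ * n ^ r) * #M + t * #M := by
        gcongr
        linarith
    _ = #M * (16 * t * γ * n ^ r + 16 * t) / 16 := by ring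
    _ ≤ #M * (α * n ^ r + α * n ^ r) / 16 := by gcongr
    _ = #M * (α * n ^ r / 8) := by ring

theorem exists_isRobustExpander_of_free [Fintype V] [Nonempty V] {s t : ℕ} (hs : 2 ≤ s)
    (hst : s ≤ t) (hG : (completeBipartiteGraph (Fin s) (Fin t)).Free G) {α γ : ℝ} (hα : 0 < α)
    (hγ0 : 0 ≤ γ) (hγ1 : γ ≤ 1) (hγ : 16 * t * γ ≤ α)
    (ht : 16 * t ≤ α * (Fintype.card V : ℝ) ^ (1 - 1 / s : ℝ))
    (hedges : α * (Fintype.card V : ℝ) ^ (2 - 1 / s : ℝ) ≤ G.edgeSet.ncard) {k : ℕ}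
    (hk : 2 * k ≤ γ ^ 2 * Fintype.card V) :
    ∃ U : Finset V, k ≤ #U ∧
      IsRobustExpander G U k k (k * (α * (Fintype.card V : ℝ) ^ (1 - 1 / s : ℝ) / 4)) := by
  classical
  set X : ℝ := (Fintype.card V : ℝ) ^ (1 - 1 / s : ℝ) with hX
  have hn : 0 < (Fintype.card V : ℝ) := by exact_mod_cast Fintype.card_pos
  have hαX : 0 < α * X := by positivity
  have hnX : (Fintype.card V : ℝ) ^ (2 - 1 / s : ℝ) = Fintype.card V * X := by
    rw [hX, show (2 - 1 / s : ℝ) = 1 + (1 - 1 / s) by ring, Real.rpow_add hn, Real.rpow_one]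
  have sparse : ∀ M : Finset V, #M ≤ 2 * k → (#(G.interedges M M) : ℝ) ≤ #M * (α * X / 8) :=
    fun M hM => card_interedges_self_le_of_free hs hst hG hγ0 hγ1 hγ hn.le ht
      (hk.trans' (by exact_mod_cast hM))
  obtain ⟨U, hU, hUdeg⟩ := exists_nonempty_forall_ncard_edgeSet_le G
  have hdeg : ∀ v ∈ U, α * X ≤ #{w ∈ U | G.Adj v w} := fun v hv => by
    refine le_of_mul_le_mul_left ?_ hn
    calc Fintype.card V * (α * X) = α * (Fintype.card V : ℝ) ^ (2 - 1 / s : ℝ) := by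
          rw [hnX]
          ring
      _ ≤ G.edgeSet.ncard := hedges
      _ ≤ Fintype.card V * #{w ∈ U | G.Adj v w} := by exact_mod_cast hUdeg v hv
  refine ⟨U, ?_, fun W M hWM hMU hkW hMk => ?_⟩
  · by_contra! hUk
    have hdense := card_mul_le_card_interedges G hdeg
    have hUpos : 0 < (#U : ℝ) := by exact_mod_cast hU.card_pos
    nlinarith [sparse U (by lia), mul_pos hUpos hαX]
  · have hdense := card_mul_le_card_interedges G fun v hv => hdeg v (hMU (hWM hv))
    have hsplit := card_interedges_add_sdiff G W hMU
    have hinside := card_le_card (G.interedges_mono hWM subset_rfl (t₂ := M))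
    have hsparse := sparse M (by lia)
    have hMW : (#M : ℝ) ≤ 4 * #W := by exact_mod_cast (show #M ≤ 4 * #W by lia)
    have hkW' : (k : ℝ) ≤ 2 * #W := by exact_mod_cast hkW
    rify at hsplit hinside
    calc k * (α * X / 4) ≤ 2 * #W * (α * X / 4) := by gcongr
      _ = #W * (α * X) - 4 * #W * (α * X / 8) := by ring
      _ ≤ #W * (α * X) - #M * (α * X / 8) := by gcongr
      _ ≤ #(G.interedges W (U \ M)) := by linarith

end EdgeCounting

section Percolation

open Finset SimpleGraph

theorem setBernoulli_real_forall_notMem {ι : Type*} {u : Set ι} (p : unitInterval) {F : Finset ι}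
    (hF : (F : Set ι) ⊆ u) :
    (setBernoulli u p).real {s | ∀ i ∈ F, i ∉ s} = (1 - p : ℝ) ^ #F := by
  have hpi : (fun q : ι → Prop => {i | q i}) ⁻¹' {s | ∀ i ∈ F, i ∉ s} =
      Set.pi F fun _ => {False} := by
    ext q
    simp [Set.mem_pi]
  rw [measureReal_def, setBernoulli_apply', hpi, Measure.infinitePi_pi _ fun _ _ => .of_discrete,
    Finset.prod_congr rfl (g := fun _ => (unitInterval.toNNReal (unitInterval.symm p) : ENNReal))]
  · simp
  · intro i hi
    have hiu : i ∈ u := hF hi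
    simp [hiu]

variable {V : Type*} {G : SimpleGraph V}

theorem percolation_real_forall_notMem_edgeSet_le [Countable V] (p : unitInterval)
    {F : Finset (Sym2 V)} (hF : (F : Set (Sym2 V)) ⊆ G.edgeSet) :
    (G.percolation p).real {H | ∀ e ∈ F, e ∉ H.edgeSet} ≤ Real.exp (-(p * #F)) := by
  have hp : (0 : ℝ) ≤ 1 - p := sub_nonneg.2 p.2.2
  calc (G.percolation p).real {H | ∀ e ∈ F, e ∉ H.edgeSet}
      ≤ (setBernoulli G.edgeSet p).real {s | ∀ e ∈ F, e ∉ s} := by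
        rw [percolation, measureReal_def, measurableEmbedding_edgeSet.comap_apply,
          ← measureReal_def]
        refine measureReal_mono ?_
        rintro _ ⟨H, hH, rfl⟩
        exact hH
    _ = (1 - p : ℝ) ^ #F := setBernoulli_real_forall_notMem p hF
    _ ≤ Real.exp (-p) ^ #F := by
        gcongr
        exact Real.one_sub_le_exp_neg _
    _ = Real.exp (-(p * #F)) := by
        rw [← Real.exp_nat_mul]
        ring_nf

theorem card_image_interedges [DecidableEq V] [DecidableRel G.Adj] {A B : Finset V}
    (hAB : Disjoint A B) : #((G.interedges A B).image Sym2.mk.uncurry) = #(G.interedges A B) := by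
  refine card_image_of_injOn ?_
  rintro ⟨a, b⟩ hab ⟨c, d⟩ hcd h
  rw [mem_coe, mk_mem_interedges_iff] at hab hcd
  rcases Sym2.eq_iff.1 h with ⟨rfl, rfl⟩ | ⟨rfl, rfl⟩
  · rfl
  · exact absurd hcd.2.1 (disjoint_left.1 hAB hab.1)

theorem percolation_real_forall_not_adj_le [Countable V] [DecidableRel G.Adj] (p : unitInterval)
    {A B : Finset V} (hAB : Disjoint A B) {x : ℝ} (hx : x ≤ #(G.interedges A B)) :
    (G.percolation p).real {H | ∀ a ∈ A, ∀ b ∈ B, ¬H.Adj a b} ≤ Real.exp (-(p * x)) := by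
  classical
  set F : Finset (Sym2 V) := (G.interedges A B).image Sym2.mk.uncurry
  have hFG : (F : Set (Sym2 V)) ⊆ G.edgeSet := by
    intro e he
    obtain ⟨ab, hab, rfl⟩ := mem_image.1 he
    exact ((mem_interedges_iff _).1 hab).2.2
  have hp : (0 : ℝ) ≤ p := p.2.1
  calc (G.percolation p).real {H | ∀ a ∈ A, ∀ b ∈ B, ¬H.Adj a b}
      ≤ (G.percolation p).real {H | ∀ e ∈ F, e ∉ H.edgeSet} := by
        refine measureReal_mono fun H hH e he => ?_
        obtain ⟨ab, hab, rfl⟩ := mem_image.1 he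
        rw [mem_interedges_iff] at hab
        exact hH _ hab.1 _ hab.2.1
    _ ≤ Real.exp (-(p * #F)) := percolation_real_forall_notMem_edgeSet_le p hFG
    _ ≤ Real.exp (-(p * x)) := by
        rw [card_image_interedges hAB]
        gcongr

theorem IsRobustExpander.le_percolation_real [Fintype V] {U : Finset V} {k m : ℕ} {x : ℝ}
    (hG : IsRobustExpander G U k m x) (p : unitInterval) :
    1 - 4 ^ Fintype.card V * Real.exp (-(p * x)) ≤
      (G.percolation p).real {H | IsRobustExpander H U k m 1} := by
  classical
  set μ := G.percolation p
  set E : Set (SimpleGraph V) := {H | IsRobustExpander H U k m 1}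
  let I : Finset (Finset V × Finset V) :=
    {q | q.1 ⊆ q.2 ∧ q.2 ⊆ U ∧ k ≤ 2 * #q.1 ∧ #q.2 < k + m}
  let bad : Finset V × Finset V → Set (SimpleGraph V) :=
    fun q => {H | ∀ a ∈ q.1, ∀ b ∈ U \ q.2, ¬H.Adj a b}
  have hcover : Set.univ ⊆ E ∪ ⋃ q ∈ I, bad q := by
    refine fun H _ => or_iff_not_imp_right.2 fun hgood W M hWM hMU hkW hM => ?_
    have hI : (W, M) ∈ I := mem_filter.2 ⟨mem_univ _, hWM, hMU, hkW, hM⟩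
    obtain ⟨a, ha, b, hb, hab⟩ : ∃ a ∈ W, ∃ b ∈ U \ M, H.Adj a b := by
      by_contra! hnone
      exact hgood (Set.mem_biUnion hI hnone)
    exact_mod_cast card_pos.2 ⟨(a, b), (mk_mem_interedges_iff H).2 ⟨ha, hb, hab⟩⟩
  have hbad : ∀ q ∈ I, μ.real (bad q) ≤ Real.exp (-(p * x)) := fun q hq => by
    obtain ⟨-, hWM, hMU, hkW, hM⟩ := mem_filter.1 hq
    exact percolation_real_forall_not_adj_le p (disjoint_sdiff.mono_left hWM)
      (hG _ _ hWM hMU hkW hM)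
  have hcardI : #I ≤ 4 ^ Fintype.card V := (card_le_univ I).trans_eq <| by
    rw [Fintype.card_prod, Fintype.card_finset, ← mul_pow]
    norm_num
  have hunion : (1 : ℝ) ≤ μ.real E + 4 ^ Fintype.card V * Real.exp (-(p * x)) :=
    calc (1 : ℝ) = μ.real Set.univ := probReal_univ.symm
      _ ≤ μ.real E + μ.real (⋃ q ∈ I, bad q) :=
        (measureReal_mono hcover).trans (measureReal_union_le _ _)
      _ ≤ μ.real E + ∑ q ∈ I, μ.real (bad q) := by
        gcongr
        exact measureReal_biUnion_finset_le _ _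
      _ ≤ μ.real E + #I * Real.exp (-(p * x)) := by
        rw [← nsmul_eq_mul]
        gcongr
        exact sum_le_card_nsmul _ _ _ hbad
      _ ≤ μ.real E + 4 ^ Fintype.card V * Real.exp (-(p * x)) := by
        gcongr
        exact_mod_cast hcardI
  linarith

theorem four_pow_mul_exp_neg_le {n : ℕ} {z : ℝ} (hz : 3 * n ≤ z) :
    4 ^ n * Real.exp (-z) ≤ Real.exp (-n) := by
  have hfour : (4 : ℝ) ≤ Real.exp 2 :=
    calc (4 : ℝ) = 2 ^ 2 := by norm_num
      _ ≤ Real.exp 1 ^ 2 := by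
        gcongr
        exact Real.exp_one_gt_two.le
      _ = Real.exp 2 := by rw [← Real.exp_nat_mul, Nat.cast_ofNat, mul_one]
  calc (4 : ℝ) ^ n * Real.exp (-z) ≤ Real.exp 2 ^ n * Real.exp (-(3 * n)) := by gcongr
    _ = Real.exp (-n) := by
      rw [← Real.exp_nat_mul, ← Real.exp_add]
      ring_nf

theorem le_percolation_real_hasCycleOfLengthAtLeast_of_free [Fintype V] [Nonempty V] {s t : ℕ}
    (hs : 2 ≤ s) (hst : s ≤ t) (hG : (completeBipartiteGraph (Fin s) (Fin t)).Free G) {α γ : ℝ}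
    (hα : 0 < α) (hγ0 : 0 < γ) (hγ1 : γ ≤ 1) (hγ : 16 * t * γ ≤ α)
    (ht : 16 * t ≤ α * (Fintype.card V : ℝ) ^ (1 - 1 / s : ℝ))
    (hn : 4 ≤ γ ^ 2 * Fintype.card V)
    (hedges : α * (Fintype.card V : ℝ) ^ (2 - 1 / s : ℝ) ≤ G.edgeSet.ncard) {p : unitInterval}
    (hp : 48 / (α * γ ^ 2) / (Fintype.card V : ℝ) ^ (1 - 1 / s : ℝ) ≤ p) :
    1 - Real.exp (-Fintype.card V) ≤
      (G.percolation p).real {H | H.HasCycleOfLengthAtLeast (γ ^ 2 / 2 * Fintype.card V)} := by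
  set n : ℝ := (Fintype.card V : ℝ)
  set X : ℝ := n ^ (1 - 1 / s : ℝ)
  have hX : 0 < X := Real.rpow_pos_of_pos (by simpa [n] using Fintype.card_pos) _
  set k : ℕ := ⌊γ ^ 2 * n / 2⌋₊
  have hk_le : (k : ℝ) ≤ γ ^ 2 * n / 2 := Nat.floor_le (by positivity)
  have hk_lt : γ ^ 2 * n / 2 < k + 1 := Nat.lt_floor_add_one _
  have hk2 : 2 ≤ k := Nat.le_floor (by push_cast; linarith)
  obtain ⟨U, hkU, hU⟩ :=
    exists_isRobustExpander_of_free hs hst hG hα hγ0.le hγ1 hγ ht hedges (k := k) (by linarith)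
  have hmean : 3 * n ≤ p * (k * (α * X / 4)) :=
    calc 3 * n = 48 / (α * γ ^ 2) / X * (γ ^ 2 * n / 4 * (α * X / 4)) := by
          field_simp
          ring
      _ ≤ p * (k * (α * X / 4)) := by
          gcongr
          · exact p.2.1
          · linarith
  calc 1 - Real.exp (-n) ≤ 1 - 4 ^ Fintype.card V * Real.exp (-(p * (k * (α * X / 4)))) := by
        gcongr
        exact four_pow_mul_exp_neg_le hmean
    _ ≤ (G.percolation p).real {H | IsRobustExpander H U k k 1} := hU.le_percolation_real p
    _ ≤ (G.percolation p).real {H | H.HasCycleOfLengthAtLeast (γ ^ 2 / 2 * n)} := by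
        refine measureReal_mono fun H hH => ?_
        obtain ⟨v, w, hw, hlen⟩ := hH.hasCycleOfLengthAtLeast one_pos hk2 hkU
        exact ⟨v, w, hw, by linarith⟩

end Percolation

theorem mainTheorem3_general (α : ℝ) (hα : 0 < α) (t : ℕ) :
    ∃ K : ℝ, 0 < K ∧ ∃ c : ℝ, 0 < c ∧ ∃ n₀ : ℕ,
      ∀ {V : Type*} [Fintype V], n₀ ≤ Fintype.card V →
        ∀ s : ℕ, 2 ≤ s → s ≤ t →
          ∀ G : SimpleGraph V,
            (completeBipartiteGraph (Fin s) (Fin t)).Free G →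
            α * (Fintype.card V : ℝ) ^ (2 - 1 / (s : ℝ)) ≤ (G.edgeSet.ncard : ℝ) →
            ∀ p : unitInterval, K / (Fintype.card V : ℝ) ^ (1 - 1 / (s : ℝ)) ≤ (p : ℝ) →
              1 - Real.exp (-Fintype.card V) ≤
                (G.percolation p).real
                  {H | H.HasCycleOfLengthAtLeast (c * (Fintype.card V : ℝ))} := by
  set γ : ℝ := α / (α + 16 * t)
  have hγ0 : 0 < γ := by positivity
  have hγ1 : γ ≤ 1 := div_le_one_of_le₀ (by linarith [t.cast_nonneg (α := ℝ)]) (by positivity)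
  have hγα : 16 * t * γ ≤ α := by
    rw [mul_div_assoc', div_le_iff₀ (by positivity)]
    nlinarith
  refine ⟨48 / (α * γ ^ 2), by positivity, γ ^ 2 / 2, by positivity,
    max 1 (max ⌈4 / γ ^ 2⌉₊ ⌈(16 * t / α) ^ 2⌉₊), fun {V} _ hn s hs hst G hG hedges p hp => ?_⟩
  rw [max_le_iff, max_le_iff, Nat.ceil_le, Nat.ceil_le] at hn
  obtain ⟨hn_one, hn_γ, hn_t⟩ := hn
  have : Nonempty V := Fintype.card_pos_iff.1 hn_one
  have ht : 16 * t / α ≤ (Fintype.card V : ℝ) ^ (1 - 1 / s : ℝ) :=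
    calc 16 * t / α ≤ √(Fintype.card V) := Real.le_sqrt_of_sq_le hn_t
      _ = (Fintype.card V : ℝ) ^ (1 / 2 : ℝ) := Real.sqrt_eq_rpow _
      _ ≤ (Fintype.card V : ℝ) ^ (1 - 1 / s : ℝ) := by
        have hinv : (1 / s : ℝ) ≤ 1 / 2 := by
          gcongr
          exact_mod_cast hs
        gcongr
        · exact_mod_cast hn_one
        · linarith
  exact le_percolation_real_hasCycleOfLengthAtLeast_of_free hs hst hG hα hγ0 hγ1 hγα
    ((div_le_iff₀' hα).1 ht) ((div_le_iff₀' (by positivity)).1 hn_γ) hedges hp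

theorem mainTheorem3 (α : ℝ) (hα : 0 < α) (t : ℕ) :
    ∃ K : ℝ, 0 < K ∧ ∃ c : ℝ, 0 < c ∧
      ∀ η : ℝ, 0 < η → ∃ n₀ : ℕ, ∀ n : ℕ, n₀ ≤ n →
        ∀ s : ℕ, 2 ≤ s → s ≤ t →
          ∀ G : SimpleGraph (Fin n),
            (completeBipartiteGraph (Fin s) (Fin t)).Free G →
            α * (n : ℝ) ^ (2 - 1 / (s : ℝ)) ≤ (G.edgeSet.ncard : ℝ) →
            ∀ p : unitInterval, K / (n : ℝ) ^ (1 - 1 / (s : ℝ)) ≤ (p : ℝ) →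
              1 - η ≤ (G.percolation p).real {H | H.HasCycleOfLengthAtLeast (c * (n : ℝ))} := by
  obtain ⟨K, hK, c, hc, n₀, h⟩ := mainTheorem3_general α hα t
  refine ⟨K, hK, c, hc, fun η hη => ?_⟩
  obtain ⟨n₁, hn₁⟩ := Filter.eventually_atTop.1 <| (Real.tendsto_exp_neg_atTop_nhds_zero.comp
    tendsto_natCast_atTop_atTop).eventually_lt_const hη
  refine ⟨max n₀ n₁, fun n hn s hs hst G hG hedges p hp => ?_⟩
  have hprob := h (V := Fin n) (by simpa using le_of_max_le_left hn) s hs hst G hG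
  rw [Fintype.card_fin] at hprob
  exact (sub_le_sub_left (hn₁ n (le_of_max_le_right hn)).le 1).trans (hprob hedges p hp)
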